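/- Theorem 1.5. Let $\mathbb B_2=\{x\in\mathbb R^2:\|x\|\le 1\}$ be the Euclidean unit disk, and let $K\subset\mathbb R^2$ be a convex body (a compact convex set with nonempty interior). For $u\in\mathbb R^2\setminus\{0\}$ let $$b_u(K,\mathbb B_2)=\frac{\max_{x,y\in K}u^{T}(x-y)}{\max_{x\in\mathbb B_2}u^{T}x},\qquad w(K,\mathbb B_2)=\min_{u\ne 0}b_u(K,\mathbb B_2),\qquad D(K,\mathbb B_2)=\max_{u\neq 0}b_u(K,\mathbb B_2),$$ $$r(K,\mathbb B_2)=\sup\{\rho>0:\ t+\rho\,\mathbb B_2\subset K\text{ for some }t\in\mathbb R^2\},\qquad R(K,\mathbb B_2)=\inf\{\rho>0:\ K\subset t+\rho\,\mathbb B_2\text{ for some }t\in\mathbb R^2\}.$$ Call $K$ pseudo-complete with respect to $\mathbb B_2$ if $r(K,\mathbb B_2)+R(K,\mathbb B_2)=D(K,\mathbb B_2)$. Put $$t=\sqrt[3]{\tfrac{32}{9}}\left(\sqrt[3]{9+\sqrt{69}}+\sqrt[3]{9-\sqrt{69}}\right),\qquad r=\frac12\left(\sqrt t+\sqrt{\frac{16}{\sqrt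 t}-t}\right)-1 .$$ Then $0.7935<r<0.7936$ and $1.1300<\frac12\left(1+\frac1r\right)<1.1301$, and every convex body $K\subset\mathbb R^2$ that is pseudo-complete with respect to $\mathbb B_2$ satisfies $$\frac{D(K,\mathbb B_2)}{w(K,\mathbb B_2)}\le\frac12\left(1+\frac1r\right).$$ Moreover, the hood $$\mathbb H=\mathrm{conv}\left(\left\{\begin{pmatrix}0\\1\end{pmatrix},\begin{pmatrix}r\\-\sqrt{1-r^2}\end{pmatrix},\begin{pmatrix}-r\\-\sqrt{1-r^2}\end{pmatrix}\right\}\cup r\,\mathbb B_2\right),$$ and every set similar to it, is a convex body that is pseudo-complete with respect to $\mathbb B_2$ and satisfies this inequality with equality. -/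

import Mathlib

open scoped Pointwise

noncomputable section

namespace MinkowskiGeom

/-- A (convex) body in `ℝⁿ`: a compact convex set with nonempty interior. -/
def IsBody {n : ℕ} (K : Set (EuclideanSpace ℝ (Fin n))) : Prop :=
  Convex ℝ K ∧ IsCompact K ∧ (interior K).Nonempty

/-- The `u`-breadth of `K` with respect to `C`:
`b_u(K, C) = (max_{x, y ∈ K} uᵀ(x - y)) / (max_{x ∈ C} uᵀx)`. -/
def breadth {n : ℕ} (K C : Set (EuclideanSpace ℝ (Fin n))) (u : EuclideanSpace ℝ (Fin n)) : ℝ :=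
  sSup {a : ℝ | ∃ x ∈ K, ∃ y ∈ K, a = inner ℝ u (x - y)} /
    sSup {a : ℝ | ∃ x ∈ C, a = inner ℝ u x}

/-- The width `w(K, C)`: the minimal breadth over all directions `u ≠ 0`. -/
def width {n : ℕ} (K C : Set (EuclideanSpace ℝ (Fin n))) : ℝ :=
  sInf {b : ℝ | ∃ u : EuclideanSpace ℝ (Fin n), u ≠ 0 ∧ b = breadth K C u}

/-- The diameter `D(K, C)`: the maximal breadth over all directions `u ≠ 0`. -/
def diameter {n : ℕ} (K C : Set (EuclideanSpace ℝ (Fin n))) : ℝ :=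
  sSup {b : ℝ | ∃ u : EuclideanSpace ℝ (Fin n), u ≠ 0 ∧ b = breadth K C u}

/-- The circumradius `R(K, C) = inf {ρ > 0 : K ⊆ t + ρ C for some t}`. -/
def circumradius {n : ℕ} (K C : Set (EuclideanSpace ℝ (Fin n))) : ℝ :=
  sInf {ρ : ℝ | 0 < ρ ∧ ∃ t : EuclideanSpace ℝ (Fin n), K ⊆ t +ᵥ (ρ • C)}

/-- The inradius `r(K, C) = sup {ρ > 0 : t + ρ C ⊆ K for some t}`. -/
def inradius {n : ℕ} (K C : Set (EuclideanSpace ℝ (Fin n))) : ℝ :=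
  sSup {ρ : ℝ | 0 < ρ ∧ ∃ t : EuclideanSpace ℝ (Fin n), t +ᵥ (ρ • C) ⊆ K}

/-- `K` is a body that is pseudo-complete with respect to `C`: `r(K, C) + R(K, C) = D(K, C)`. -/
def IsPseudoComplete {n : ℕ} (K C : Set (EuclideanSpace ℝ (Fin n))) : Prop :=
  IsBody K ∧ inradius K C + circumradius K C = diameter K C

/-- The Euclidean unit disk. -/
def unitDisk : Set (EuclideanSpace ℝ (Fin 2)) := Metric.closedBall 0 1

/-- The constant `t = ∛(32/9) (∛(9 + √69) + ∛(9 - √69))`; all radicands are positive. -/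
def tConst : ℝ :=
  (32 / 9 : ℝ) ^ (1 / 3 : ℝ) *
    ((9 + √69) ^ (1 / 3 : ℝ) + (9 - √69) ^ (1 / 3 : ℝ))

/-- The constant `r = (√t + √(16 / √t - t)) / 2 - 1`. -/
def rConst : ℝ := (√tConst + √(16 / √tConst - tConst)) / 2 - 1

/-- The hood: the convex hull of the three points `(0, 1)`, `(± r, -√(1 - r²))` of the unit circle
and the disk of radius `r` centred at the origin. -/
def hood : Set (EuclideanSpace ℝ (Fin 2)) :=
  convexHull ℝ
    ({!₂[0, 1], !₂[rConst, -√(1 - rConst ^ 2)], !₂[-rConst, -√(1 - rConst ^ 2)]} ∪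
      rConst • unitDisk)

/-- A hood: any set similar to the hood just defined, that is, a dilate of an isometric copy. -/
def IsHood (K : Set (EuclideanSpace ℝ (Fin 2))) : Prop :=
  ∃ (c : ℝ) (e : EuclideanSpace ℝ (Fin 2) ≃ᵢ EuclideanSpace ℝ (Fin 2)), 0 < c ∧ K = c • (e '' hood)

end MinkowskiGeom

end

namespace MinkowskiGeom

/-! Pseudo-completeness makes the inball and the circumball concentric. If the disk of radius `r`
about `c` lies in `K`, every point of `K` is within `D - r` of `c`, and `D - r = R`. By minimality
of `R`, the points of `K` on the circle of radius `R` about `c` have `c` in their convex hull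
(`center_mem_convexHull`), and by Carathéodory three of them suffice.

Scale to `R = 1` and put `ρ = r / R`. If `ρ ≥ rConst`, the bound follows from `D = r + R` and from
every breadth being at least `2 r`. If `ρ < rConst`, the three contact points are balanced unit
vectors at mutual distances at most `1 + ρ`. Each pair is therefore far from coincident, and in any
direction two of the three lie on the same side of the axis. Such a pair forces the supporting
strip, which also contains the disk of radius `ρ`, to be at least `2 * rConst` wide
(`two_rConst_le_of_strip`). Together with `D < (1 + rConst) R` this gives the same bound.

The constant marks the balance of the two cases. It is the radius for which a foot `(r, -√(1 - r²))`
of the hood is at distance exactly `1 + r` from the apex, so the hood has concentric balls of radii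
`r` and `1`, diameter `1 + r` and width `2 r`. -/

/-! ### The constants. -/

theorem tConst_pos : 0 < tConst := by
  have h : √69 < 9 := by
    rw [Real.sqrt_lt' (by norm_num)]; norm_num
  have h' : (0 : ℝ) < 9 - √69 := by linarith
  unfold tConst
  positivity

/-- Cardano's formula, checked backwards. This cubic is the resolvent of the quartic in
`rConst_quartic`. -/
theorem tConst_cubic : tConst ^ 3 = 16 * tConst + 64 := by
  have h : √69 < 9 := by
    rw [Real.sqrt_lt' (by norm_num)]; norm_num
  have h' : (0 : ℝ) < 9 - √69 := by linarith
  have h69 : √69 ^ 2 = (69 : ℝ) := Real.sq_sqrt (by norm_num)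
  have cube : ∀ z : ℝ, 0 ≤ z → (z ^ (1 / 3 : ℝ)) ^ 3 = z := fun z hz => by
    rw [← Real.rpow_natCast, ← Real.rpow_mul hz]; norm_num
  have hk := cube (32 / 9) (by norm_num)
  have ha := cube (9 + √69) (by positivity)
  have hb := cube (9 - √69) h'.le
  have hk0 : 0 < (32 / 9 : ℝ) ^ (1 / 3 : ℝ) := by positivity
  have ha0 : 0 < (9 + √69) ^ (1 / 3 : ℝ) := by positivity
  have hb0 : 0 < (9 - √69) ^ (1 / 3 : ℝ) := by positivity
  unfold tConst
  set k := (32 / 9 : ℝ) ^ (1 / 3 : ℝ)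
  set a := (9 + √69) ^ (1 / 3 : ℝ)
  set b := (9 - √69) ^ (1 / 3 : ℝ)
  have hp : k ^ 2 * a * b = 16 / 3 := by
    refine (pow_left_inj₀ (by positivity) (by norm_num) three_ne_zero).1 ?_
    calc (k ^ 2 * a * b) ^ 3 = (k ^ 3) ^ 2 * (a ^ 3 * b ^ 3) := by ring
      _ = (32 / 9) ^ 2 * (81 - √69 ^ 2) := by rw [hk, ha, hb]; ring
      _ = _ := by rw [h69]; norm_num
  calc (k * (a + b)) ^ 3 = k ^ 3 * (a ^ 3 + b ^ 3) + 3 * (k ^ 2 * a * b) * (k * (a + b)) := by ring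
    _ = _ := by rw [hk, ha, hb, hp]; ring

/-- Ferrari's method: `√tConst` is the linear coefficient, up to sign, in a splitting of the quartic
into two real quadratics. The second conjunct excludes the other real root, which is below `1`. -/
theorem rConst_quartic : (1 + rConst) ^ 4 - 8 * (1 + rConst) + 4 = 0 ∧ 1 < 1 + rConst := by
  have ht := tConst_cubic
  have ht0 := tConst_pos
  have h1 : 5.25 < tConst := by
    by_contra! h; nlinarith [mul_pos ht0 ht0, mul_nonneg ht0.le (sub_nonneg.2 h)]
  have h2 : tConst < 5.3 := by
    by_contra! h
    nlinarith [mul_pos ht0 ht0, mul_nonneg (mul_pos ht0 ht0).le (sub_nonneg.2 h)]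
  have hs2 : √tConst ^ 2 = tConst := Real.sq_sqrt ht0.le
  have hs0 : 0 < √tConst := Real.sqrt_pos.2 ht0
  have hs1 : 2.25 < √tConst := by rw [Real.lt_sqrt (by norm_num)]; norm_num; linarith
  have hs3 : √tConst < 2.31 := by rw [Real.sqrt_lt' (by norm_num)]; norm_num; linarith
  have hd : 1 ≤ 16 / √tConst - tConst := by
    have : 6.9 ≤ 16 / √tConst := by rw [le_div_iff₀ hs0]; linarith
    linarith
  have hv2 : √(16 / √tConst - tConst) ^ 2 = 16 / √tConst - tConst := Real.sq_sqrt (by linarith)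
  have hv1 : 1 ≤ √(16 / √tConst - tConst) := by rw [Real.one_le_sqrt]; exact hd
  unfold rConst
  set a := √tConst
  set v := √(16 / a - tConst)
  have e : 16 / a * a = 16 := by field_simp
  have hv : v ^ 2 * a = 16 - a ^ 3 := by rw [hv2, ← hs2]; linarith [e, pow_succ a 2]
  have ha6 : a ^ 6 = 16 * a ^ 2 + 64 := by rw [← hs2] at ht; linarith [ht]
  constructor
  · have key : a ^ 2 * ((1 + ((a + v) / 2 - 1)) ^ 4 - 8 * (1 + ((a + v) / 2 - 1)) + 4) = 0 := by
      have h4 : v ^ 4 * a ^ 2 = (16 - a ^ 3) ^ 2 := by rw [← hv]; ring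
      have e : a ^ 2 * ((1 + ((a + v) / 2 - 1)) ^ 4 - 8 * (1 + ((a + v) / 2 - 1)) + 4)
          = (a ^ 6 + 4 * a ^ 4 * (v * a) + 6 * a ^ 3 * (v ^ 2 * a) + 4 * (v * a) * a * (v ^ 2 * a)
            + v ^ 4 * a ^ 2) / 16 - 4 * a ^ 3 - 4 * a * (v * a) + 4 * a ^ 2 := by ring
      rw [e, hv, h4]
      linear_combination (-1 / 4) * ha6
    exact (mul_eq_zero.1 key).resolve_left (by positivity)
  · linarith

/-- The fifth digit of the lower bound is needed: `0.7935` would not give `1.1301` for the ratio. -/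
theorem rConst_bounds : 0.79353 < rConst ∧ rConst < 0.7936 := by
  obtain ⟨h, h1⟩ := rConst_quartic
  set D := 1 + rConst with hD
  constructor
  · by_contra! hr
    have hD' : D ≤ 1.79353 := by rw [hD]; linarith
    have a1 : D ^ 2 ≤ 1.79353 ^ 2 := by gcongr
    nlinarith [mul_nonneg (sub_nonneg.2 hD') (sub_nonneg.2 h1.le), mul_nonneg (mul_nonneg (sub_nonneg.2 hD') (sub_nonneg.2 h1.le)) (sub_nonneg.2 h1.le)]
  · by_contra! hr
    have hD' : 1.7936 ≤ D := by rw [hD]; linarith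
    nlinarith [sq_nonneg (D ^ 2 - 1.7936 ^ 2), sq_nonneg (D - 1.7936)]

/-- The geometric form of the quartic: a unit vector at height `-m` is at distance `1 + r` from the
apex `(0, 1)` when `2 + 2 m = (1 + r)²`. -/
theorem rConst_sq_add_sq : rConst ^ 2 + ((1 + rConst) ^ 2 / 2 - 1) ^ 2 = 1 := by
  linear_combination rConst_quartic.1 / 4

theorem sqrt_one_sub_rConst_sq : √(1 - rConst ^ 2) = (1 + rConst) ^ 2 / 2 - 1 := by
  have h : 1 - rConst ^ 2 = ((1 + rConst) ^ 2 / 2 - 1) ^ 2 := by linarith [rConst_sq_add_sq]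
  rw [h, Real.sqrt_sq]
  nlinarith [rConst_bounds.1]

theorem half_one_add_inv_rConst :
    (1.1300 : ℝ) < (1 / 2 : ℝ) * (1 + 1 / rConst) ∧ (1 / 2 : ℝ) * (1 + 1 / rConst) < 1.1301 := by
  obtain ⟨h1, h2⟩ := rConst_bounds
  have h0 : 0 < rConst := by linarith
  have e1 : (1.26 : ℝ) < 1 / rConst := by rw [lt_div_iff₀ h0]; linarith
  have e2 : 1 / rConst < (1.2602 : ℝ) := by rw [div_lt_iff₀ h0]; linarith
  constructor <;> linarith

/-! ### Balanced unit vectors in a strip. -/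

/-- If `H₁, H₂ ≥ ρ` bound the strip, the final quadratic inequality forces `H₁ + H₂ ≥ 2 r`. -/
theorem two_rConst_le_of_quadratic {ρ m s : ℝ} (hm : m = (1 + ρ) ^ 2 / 2 - 1) (hm1 : 1 / 2 ≤ m)
    (hρ : 0 < ρ) (hρr : ρ < rConst) (hs : 2 * ρ ≤ s)
    (h : 4 * (1 - m ^ 2) * (m ^ 2 + ρ * s - ρ ^ 2) ≤ s ^ 2) : 2 * rConst ≤ s := by
  by_contra! hlt
  obtain ⟨h1, h2⟩ := rConst_bounds
  have hq := rConst_sq_add_sq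
  set r := rConst
  set m₀ := (1 + r) ^ 2 / 2 - 1 with hm₀
  -- `m ≥ 1 / 2` means `ρ ≥ √3 - 1`, the value for an equilateral triangle.
  have hρ1 : 0.732 < ρ := by
    by_contra! hc
    have : (1 + ρ) ^ 2 ≤ 1.732 ^ 2 := by gcongr; linarith
    linarith
  have hrr : 0 < r - ρ := by linarith
  have hd : m₀ - m = (r - ρ) * ((2 + r + ρ) / 2) := by rw [hm₀, hm]; ring
  clear_value m₀
  clear hm hm₀
  have hmm : (r - ρ) * 1.7 ≤ m₀ - m := by
    rw [hd]; exact mul_le_mul_of_nonneg_left (by linarith) hrr.le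
  have hε : (r - ρ) * 1.7 ≤ m₀ ^ 2 - m ^ 2 := by
    have : (m₀ - m) * 1 ≤ (m₀ - m) * (m₀ + m) :=
      mul_le_mul_of_nonneg_left (by linarith) (by linarith)
    linarith [this]
  have hsm : (r - ρ) * (r - ρ) ≤ (r - ρ) * 0.07 :=
    mul_le_mul_of_nonneg_left (by linarith) hrr.le
  have hm4 : 1 / 4 ≤ m ^ 2 := by
    have := pow_le_pow_left₀ (by norm_num) hm1 2
    linarith
  have hr2 : r ^ 2 ≤ 0.7936 ^ 2 := by gcongr
  have hρ2 : ρ ^ 2 < r ^ 2 := by gcongr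
  -- A quarter of the value at `s = 2 ρ` of the quadratic `s² - 4 (1 - m²)(m² + ρ s - ρ²)`; `g2'` is
  -- the same at `s = 2 r`.
  have g1 : m ^ 2 * (ρ ^ 2 - 1 + m ^ 2) < 0 := by
    apply mul_neg_of_pos_of_neg <;> linarith
  -- The left side is quadratic in the small quantity `r - ρ`, the right side at least linear.
  have g2 : r ^ 2 * (r - ρ) ^ 2 < (m₀ ^ 2 - m ^ 2) * (m ^ 2 - (r - ρ) ^ 2) := by
    have h3 : 0.24 ≤ m ^ 2 - (r - ρ) ^ 2 := by
      have : (r - ρ) ^ 2 ≤ 0.07 ^ 2 := by gcongr; linarith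
      linarith
    have h4 : ((r - ρ) * 1.7) * 0.24 ≤ (m₀ ^ 2 - m ^ 2) * (m ^ 2 - (r - ρ) ^ 2) :=
      mul_le_mul hε h3 (by norm_num) (by linarith)
    have h5 : r ^ 2 * (r - ρ) ^ 2 ≤ 0.7936 ^ 2 * ((r - ρ) * 0.07) :=
      mul_le_mul hr2 (by linarith) (sq_nonneg _) (by norm_num)
    linarith
  have g2' : r ^ 2 - 2 * (1 - m ^ 2) * ρ * r + (1 - m ^ 2) * (ρ ^ 2 - m ^ 2) < 0 := by
    have hr : m₀ ^ 2 = 1 - r ^ 2 := by linarith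
    rw [hr] at g2
    linarith [g2]
  -- convexity in `s` between `2 ρ` and `2 r`
  have e1 := mul_nonneg hrr.le (mul_nonneg (sub_nonneg.2 hs) (sub_nonneg.2 hlt.le))
  have e2 := mul_neg_of_pos_of_neg (sub_pos.2 hlt) g1
  have e3 := mul_nonpos_of_nonneg_of_nonpos (sub_nonneg.2 hs) g2'.le
  have e5 := mul_nonneg hrr.le (sub_nonneg.2 h)
  linarith

/-- The vector with weight `a` makes an angle of at most `arccos (-m)` with each of the other two,
and the three go round the circle, so the other two are at least `2π - 2 arccos (-m)` apart. In
coefficients: `a ≤ m (b + c)`, which is squared and compared with `hsq`. -/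
theorem inner_le_of_convex_combination {m a b c pq p'q pp' : ℝ} (ha : 0 ≤ a) (hb : 0 < b)
    (hc : 0 < c) (hm : m ≤ 1) (hm0 : 0 ≤ m) (h1 : -m ≤ pq) (h2 : -m ≤ p'q)
    (hq : a + b * pq + c * p'q = 0) (hsq : a ^ 2 = b ^ 2 + c ^ 2 + 2 * b * c * pp') :
    pp' ≤ 2 * m ^ 2 - 1 := by
  have h3 : a ≤ m * (b + c) := by nlinarith
  have h4 : a ^ 2 ≤ (m * (b + c)) ^ 2 := by gcongr
  have h5 : 0 < b * c := mul_pos hb hc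
  have h6 : 0 ≤ (1 - m ^ 2) * (b - c) ^ 2 := mul_nonneg (by nlinarith) (sq_nonneg _)
  by_contra! h
  nlinarith [mul_pos h5 (sub_pos.2 h)]

/-- The vectors are on the same side but at an obtuse angle, so their heights have opposite signs.
Then `√((1 - H₁²)(1 - H₂²)) ≤ x x' ≤ 2 m² - 1 + H₁ H₂`. Squaring gives `4 (1 - m²)(m² + H₁ H₂) ≤ (H₁
+ H₂)²`, and `(H₁ - ρ)(H₂ - ρ) ≥ 0` makes this a quadratic inequality in `H₁ + H₂` alone. -/
theorem two_rConst_le_of_pair {ρ m H₁ H₂ x y x' y' : ℝ} (hm : m = (1 + ρ) ^ 2 / 2 - 1)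
    (hm1 : 1 / 2 ≤ m) (hρ : 0 < ρ) (hρr : ρ < rConst) (h₁ : ρ ≤ H₁) (h₂ : ρ ≤ H₂)
    (hp : x ^ 2 + y ^ 2 = 1) (hp' : x' ^ 2 + y' ^ 2 = 1) (hpp : x * x' + y * y' ≤ 2 * m ^ 2 - 1)
    (hx : 0 ≤ x * x') (hy₁ : y ≤ H₁) (hy₂ : -H₂ ≤ y) (hy'₁ : y' ≤ H₁) (hy'₂ : -H₂ ≤ y') :
    2 * rConst ≤ H₁ + H₂ := by
  wlog hyy : y' ≤ y generalizing x y x' y'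
  · exact this hp' hp (by linarith) (by linarith) hy'₁ hy'₂ hy₁ hy₂ (not_le.1 hyy).le
  obtain ⟨hr1, hr2⟩ := rConst_bounds
  have hq := rConst_sq_add_sq
  have hρ1 : 0.732 < ρ := by
    by_contra! hc
    have : (1 + ρ) ^ 2 ≤ 1.732 ^ 2 := by gcongr; linarith
    linarith
  -- A strip reaching past the unit circle is already wide enough, since `1 + ρ > 2 * rConst`.
  by_cases hH₁ : 1 ≤ H₁
  · linarith
  by_cases hH₂ : 1 ≤ H₂
  · linarith
  push Not at hH₁ hH₂
  have hm2 : m ^ 2 ≤ 1 - rConst ^ 2 := by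
    have : m ^ 2 ≤ ((1 + rConst) ^ 2 / 2 - 1) ^ 2 := by
      have : (1 + ρ) ^ 2 ≤ (1 + rConst) ^ 2 := by gcongr
      gcongr
      linarith
    linarith
  have hm3 : 2 * m ^ 2 - 1 < 0 := by
    have : 0.79353 ^ 2 < rConst ^ 2 := by gcongr
    linarith
  have hyneg : y * y' < 0 := by linarith
  have hy0 : 0 < y := by
    by_contra! h
    linarith [mul_nonneg_of_nonpos_of_nonpos h (hyy.trans h)]
  have hy'0 : y' < 0 := by
    by_contra! h
    linarith [mul_nonneg hy0.le h]
  have hP : -(y * y') ≤ H₁ * H₂ := by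
    have := mul_le_mul hy₁ (neg_le.1 hy'₂) (by linarith) (by linarith)
    linarith
  have hsq : (1 - H₁ ^ 2) * (1 - H₂ ^ 2) ≤ (x * x') ^ 2 := by
    have e : (x * x') ^ 2 = (1 - y ^ 2) * (1 - (-y') ^ 2) := by
      rw [mul_pow, eq_sub_of_add_eq hp, eq_sub_of_add_eq hp', neg_sq]
    have i1 : y ^ 2 ≤ H₁ ^ 2 := by gcongr
    have i2 : (-y') ^ 2 ≤ H₂ ^ 2 := pow_le_pow_left₀ (by linarith) (by linarith) 2
    have i3 : H₂ ^ 2 ≤ 1 ^ 2 := pow_le_pow_left₀ (by linarith) hH₂.le 2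
    have i4 : H₁ ^ 2 ≤ 1 ^ 2 := pow_le_pow_left₀ (by linarith) hH₁.le 2
    rw [e]
    apply mul_le_mul <;> linarith
  have hle : (x * x') ^ 2 ≤ (2 * m ^ 2 - 1 + H₁ * H₂) ^ 2 :=
    pow_le_pow_left₀ hx (by linarith) 2
  have hprod : ρ * (H₁ + H₂) - ρ ^ 2 ≤ H₁ * H₂ := by
    linarith [mul_nonneg (sub_nonneg.2 h₁) (sub_nonneg.2 h₂)]
  refine two_rConst_le_of_quadratic hm hm1 hρ hρr (by linarith) ?_
  have := mul_le_mul_of_nonneg_left hprod (a := 4 * (1 - m ^ 2)) (by linarith)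
  linarith

abbrev Plane := EuclideanSpace ℝ (Fin 2)

/-- Expanding the squared norm of the zero combination gives `0 ≥ 1 - 2 (1 + m)(ab + ac + bc)`,
where `ab + ac + bc ≤ 1 / 3`. -/
theorem half_le_of_convex_combination {m a b c : ℝ} {p q s : Plane} (ha : 0 ≤ a) (hb : 0 ≤ b)
    (hc : 0 ≤ c) (habc : a + b + c = 1) (hp : ‖p‖ = 1) (hq : ‖q‖ = 1) (hs : ‖s‖ = 1)
    (hpq : -m ≤ inner ℝ p q) (hps : -m ≤ inner ℝ p s) (hqs : -m ≤ inner ℝ q s)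
    (h : a • p + b • q + c • s = 0) : 1 / 2 ≤ m := by
  have h0 : ‖a • p + b • q + c • s‖ ^ 2 = 0 := by simp [h]
  have e : ‖a • p + b • q + c • s‖ ^ 2 = a ^ 2 + b ^ 2 + c ^ 2 + 2 * (a * b * inner ℝ p q
      + a * c * inner ℝ p s + b * c * inner ℝ q s) := by
    rw [norm_add_sq_real, norm_add_sq_real]
    simp only [inner_add_left, inner_smul_left, inner_smul_right, norm_smul, hp, hq, hs]
    simp only [Real.norm_eq_abs, mul_one, sq_abs, conj_trivial]
    ring
  have e1 := mul_le_mul_of_nonneg_left hpq (mul_nonneg ha hb)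
  have e2 := mul_le_mul_of_nonneg_left hps (mul_nonneg ha hc)
  have e3 := mul_le_mul_of_nonneg_left hqs (mul_nonneg hb hc)
  by_contra! hm
  have hab := mul_nonneg ha hb
  have hac := mul_nonneg ha hc
  have hbc := mul_nonneg hb hc
  have hsum : (a + b + c) ^ 2 = 1 := by rw [habc]; norm_num
  have e4 : a * b + a * c + b * c ≤ 1 / 3 := by
    nlinarith [sq_nonneg (a - b), sq_nonneg (a - c), sq_nonneg (b - c)]
  have e5 : m * (a * b + a * c + b * c) ≤ 1 / 2 * (a * b + a * c + b * c) :=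
    mul_le_mul_of_nonneg_right hm.le (by linarith)
  rcases eq_or_lt_of_le (show 0 ≤ a * b + a * c + b * c by linarith) with h6 | h6
  · nlinarith
  · have := mul_lt_mul_of_pos_right hm h6
    nlinarith

theorem inner_le_of_balanced {m a b c : ℝ} {p q s : Plane} (ha : 0 ≤ a) (hb : 0 ≤ b)
    (hc : 0 ≤ c) (habc : a + b + c = 1) (hp : ‖p‖ = 1) (hq : ‖q‖ = 1) (hs : ‖s‖ = 1)
    (hpq : -m ≤ inner ℝ p q) (hps : -m ≤ inner ℝ p s)
    (h : a • p + b • q + c • s = 0) (hm0 : 0 ≤ m) (hm : m < 1) :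
    inner ℝ q s ≤ 2 * m ^ 2 - 1 := by
  have hpp : inner ℝ p p = (1 : ℝ) := by rw [real_inner_self_eq_norm_sq, hp]; norm_num
  have hqq : inner ℝ q q = (1 : ℝ) := by rw [real_inner_self_eq_norm_sq, hq]; norm_num
  have hss : inner ℝ s s = (1 : ℝ) := by rw [real_inner_self_eq_norm_sq, hs]; norm_num
  have i1 : a + b * inner ℝ p q + c * inner ℝ p s = 0 := by
    have := congrArg (inner ℝ p) h
    simpa only [inner_add_right, inner_smul_right, hpp, mul_one, inner_zero_right] using this
  have i2 : a * inner ℝ p q + b + c * inner ℝ q s = 0 := by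
    have := congrArg (inner ℝ q) h
    rw [inner_add_right, inner_add_right, inner_smul_right, inner_smul_right, inner_smul_right, hqq,
      inner_zero_right] at this
    rw [real_inner_comm q p]; linarith
  have i3 : a * inner ℝ p s + b * inner ℝ q s + c = 0 := by
    have := congrArg (inner ℝ s) h
    rw [inner_add_right, inner_add_right, inner_smul_right, inner_smul_right, inner_smul_right, hss,
      inner_zero_right] at this
    rw [real_inner_comm s p, real_inner_comm s q]; linarith
  -- With one weight zero the remaining two vectors would be antipodal, which `m < 1` forbids.
  have hb0 : 0 < b := by
    refine lt_of_le_of_ne hb fun hb' => ?_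
    subst hb'
    have h1 : a ≤ m * c := by linarith [mul_le_mul_of_nonneg_left hps hc]
    have h2 : c ≤ m * a := by linarith [mul_le_mul_of_nonneg_left hps ha]
    nlinarith
  have hc0 : 0 < c := by
    refine lt_of_le_of_ne hc fun hc' => ?_
    subst hc'
    have h1 : a ≤ m * b := by linarith [mul_le_mul_of_nonneg_left hpq hb]
    have h2 : b ≤ m * a := by linarith [mul_le_mul_of_nonneg_left hpq ha]
    nlinarith
  refine inner_le_of_convex_combination ha hb0 hc0 hm.le hm0 hpq hps i1 ?_
  linear_combination a * i1 - b * i2 - c * i3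

/-- The planar core: a balanced triple of unit vectors with small mutual distances cannot lie in a
strip narrower than twice the inradius of the hood. -/
theorem two_rConst_le_of_strip {ρ H₁ H₂ a b c : ℝ} {p q s u : Plane} (hρ : 0 < ρ)
    (hρr : ρ < rConst) (h₁ : ρ ≤ H₁) (h₂ : ρ ≤ H₂) (hu : ‖u‖ = 1)
    (ha : 0 ≤ a) (hb : 0 ≤ b) (hc : 0 ≤ c) (habc : a + b + c = 1)
    (hp : ‖p‖ = 1) (hq : ‖q‖ = 1) (hs : ‖s‖ = 1) (h : a • p + b • q + c • s = 0)
    (hpq : dist p q ≤ 1 + ρ) (hps : dist p s ≤ 1 + ρ) (hqs : dist q s ≤ 1 + ρ)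
    (hp₁ : inner ℝ u p ≤ H₁) (hp₂ : -H₂ ≤ inner ℝ u p)
    (hq₁ : inner ℝ u q ≤ H₁) (hq₂ : -H₂ ≤ inner ℝ u q)
    (hs₁ : inner ℝ u s ≤ H₁) (hs₂ : -H₂ ≤ inner ℝ u s) : 2 * rConst ≤ H₁ + H₂ := by
  obtain ⟨m, hm⟩ : ∃ m, m = (1 + ρ) ^ 2 / 2 - 1 := ⟨_, rfl⟩
  have key : ∀ v w : Plane, ‖v‖ = 1 → ‖w‖ = 1 → dist v w ≤ 1 + ρ → -m ≤ inner ℝ v w := by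
    intro v w hv hw hvw
    have h1 : dist v w ^ 2 ≤ (1 + ρ) ^ 2 := by gcongr
    rw [dist_eq_norm, norm_sub_sq_real, hv, hw] at h1
    linarith
  have kpq := key p q hp hq hpq
  have kps := key p s hp hs hps
  have kqs := key q s hq hs hqs
  have hm1 := half_le_of_convex_combination ha hb hc habc hp hq hs kpq kps kqs h
  have hm2 : m < 1 := by
    have : (1 + ρ) ^ 2 < 1.7936 ^ 2 := by
      gcongr; linarith [rConst_bounds.2]
    linarith
  have hm0 : 0 ≤ m := by linarith
  -- coordinates with respect to `u` and its rotation by a right angle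
  have hin : ∀ v w : Plane, inner ℝ v w = v 0 * w 0 + v 1 * w 1 := by
    intro v w; simp [PiLp.inner_apply, Fin.sum_univ_two, mul_comm]
  have huu : u 0 ^ 2 + u 1 ^ 2 = 1 := by
    have := real_inner_self_eq_norm_sq u
    rw [hin, hu] at this
    linarith
  let X : Plane → ℝ := fun v => u 0 * v 1 - u 1 * v 0
  have hX : ∀ v w : Plane, inner ℝ v w = X v * X w + inner ℝ u v * inner ℝ u w := by
    intro v w
    simp only [hin, X]
    linear_combination -(v 0 * w 0 + v 1 * w 1) * huu
  have hX1 : ∀ v : Plane, ‖v‖ = 1 → X v ^ 2 + inner ℝ u v ^ 2 = 1 := by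
    intro v hv
    have := real_inner_self_eq_norm_sq v
    rw [hX, hv] at this
    linarith
  have pair : ∀ v w : Plane, ‖v‖ = 1 → ‖w‖ = 1 → inner ℝ v w ≤ 2 * m ^ 2 - 1 → 0 ≤ X v * X w →
      inner ℝ u v ≤ H₁ → -H₂ ≤ inner ℝ u v → inner ℝ u w ≤ H₁ → -H₂ ≤ inner ℝ u w →
      2 * rConst ≤ H₁ + H₂ := by
    intro v w hv hw hvw hx
    exact two_rConst_le_of_pair hm hm1 hρ hρr h₁ h₂ (hX1 v hv) (hX1 w hw) (by rwa [← hX]) hx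
  -- Pigeonhole: two of three real numbers share a sign.
  have hsome : 0 ≤ X q * X s ∨ 0 ≤ X p * X s ∨ 0 ≤ X p * X q := by
    rcases le_total 0 (X p) with hP | hP <;> rcases le_total 0 (X q) with hQ | hQ <;>
      rcases le_total 0 (X s) with hS | hS <;>
      simp [mul_nonneg, mul_nonneg_of_nonpos_of_nonpos, *]
  rcases hsome with hx | hx | hx
  · exact pair q s hq hs (inner_le_of_balanced ha hb hc habc hp hq hs kpq kps h hm0 hm2) hx
      hq₁ hq₂ hs₁ hs₂
  · exact pair p s hp hs (inner_le_of_balanced hb ha hc (by linarith) hq hp hs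
      (by rwa [real_inner_comm]) kqs (by rw [← h]; abel) hm0 hm2) hx hp₁ hp₂ hs₁ hs₂
  · exact pair p q hp hq (inner_le_of_balanced hc ha hb (by linarith) hs hp hq
      (by rwa [real_inner_comm]) (by rwa [real_inner_comm]) (by rw [← h]; abel) hm0 hm2) hx
      hp₁ hp₂ hq₁ hq₂

/-! ### Breadth, width and diameter for the Euclidean disk. -/

theorem vadd_smul_unitDisk (t : Plane) {ρ : ℝ} (hρ : 0 ≤ ρ) :
    t +ᵥ (ρ • unitDisk) = Metric.closedBall t ρ := by
  rw [unitDisk, smul_unitClosedBall, Real.norm_of_nonneg hρ, Metric.vadd_closedBall, vadd_eq_add, add_zero]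

theorem sSup_inner_unitDisk {u : Plane} (hu : u ≠ 0) :
    sSup {a : ℝ | ∃ x ∈ unitDisk, a = inner ℝ u x} = ‖u‖ := by
  have hu' : ‖u‖ ≠ 0 := norm_ne_zero_iff.2 hu
  refine IsGreatest.csSup_eq ⟨⟨‖u‖⁻¹ • u, ?_, ?_⟩, ?_⟩
  · simp [unitDisk, norm_smul, hu']
  · rw [inner_smul_right, real_inner_self_eq_norm_sq]; field_simp
  · rintro _ ⟨x, hx, rfl⟩
    have hx1 : ‖x‖ ≤ 1 := by simpa [unitDisk] using hx
    calc inner ℝ u x ≤ ‖u‖ * ‖x‖ := real_inner_le_norm u x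
      _ ≤ ‖u‖ := mul_le_of_le_one_right (norm_nonneg u) hx1

theorem inner_sub_le_norm_mul_diam {K : Set Plane} (hK : IsCompact K) (u : Plane) {x y : Plane}
    (hx : x ∈ K) (hy : y ∈ K) : inner ℝ u (x - y) ≤ ‖u‖ * Metric.diam K :=
  (real_inner_le_norm u _).trans (mul_le_mul_of_nonneg_left
    (by rw [← dist_eq_norm]; exact Metric.dist_le_diam_of_mem hK.isBounded hx hy) (norm_nonneg u))

theorem inner_sub_le_breadth {K : Set Plane} (hK : IsCompact K) {u : Plane} (hu : u ≠ 0)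
    {x y : Plane} (hx : x ∈ K) (hy : y ∈ K) :
    inner ℝ u (x - y) ≤ ‖u‖ * breadth K unitDisk u := by
  have hu' : 0 < ‖u‖ := norm_pos_iff.2 hu
  rw [breadth, sSup_inner_unitDisk hu, mul_div_cancel₀ _ hu'.ne']
  refine le_csSup ⟨‖u‖ * Metric.diam K, ?_⟩ ⟨x, hx, y, hy, rfl⟩
  rintro _ ⟨x, hx, y, hy, rfl⟩
  exact inner_sub_le_norm_mul_diam hK u hx hy

theorem breadth_le {K : Set Plane} (hK : K.Nonempty) {u : Plane} (hu : u ≠ 0) {b : ℝ}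
    (h : ∀ x ∈ K, ∀ y ∈ K, inner ℝ u (x - y) ≤ ‖u‖ * b) : breadth K unitDisk u ≤ b := by
  have hu' : 0 < ‖u‖ := norm_pos_iff.2 hu
  rw [breadth, sSup_inner_unitDisk hu, div_le_iff₀ hu', mul_comm]
  obtain ⟨z, hz⟩ := hK
  refine csSup_le ⟨_, z, hz, z, hz, rfl⟩ ?_
  rintro _ ⟨x, hx, y, hy, rfl⟩
  exact h x hx y hy

theorem breadth_nonneg {K : Set Plane} (hK : IsCompact K) (hne : K.Nonempty) {u : Plane}
    (hu : u ≠ 0) : 0 ≤ breadth K unitDisk u := by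
  obtain ⟨z, hz⟩ := hne
  have := inner_sub_le_breadth hK hu hz hz
  rw [sub_self, inner_zero_right] at this
  exact nonneg_of_mul_nonneg_right this (norm_pos_iff.2 hu)

theorem diameter_eq_diam {K : Set Plane} (hK : IsCompact K) (hne : K.Nonempty) :
    diameter K unitDisk = Metric.diam K := by
  have hle : ∀ u : Plane, u ≠ 0 → breadth K unitDisk u ≤ Metric.diam K := fun u hu =>
    breadth_le hne hu fun x hx y hy => inner_sub_le_norm_mul_diam hK u hx hy
  have hbdd : BddAbove {b : ℝ | ∃ u : Plane, u ≠ 0 ∧ b = breadth K unitDisk u} :=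
    ⟨Metric.diam K, by rintro _ ⟨u, hu, rfl⟩; exact hle u hu⟩
  obtain ⟨v, hv⟩ := exists_ne (0 : Plane)
  apply le_antisymm
  · refine csSup_le ⟨_, v, hv, rfl⟩ ?_
    rintro _ ⟨u, hu, rfl⟩
    exact hle u hu
  · refine Metric.diam_le_of_forall_dist_le ?_ fun x hx y hy => ?_
    · exact (breadth_nonneg hK hne hv).trans (le_csSup hbdd ⟨v, hv, rfl⟩)
    · rcases eq_or_ne x y with rfl | hxy
      · rw [dist_self]
        exact (breadth_nonneg hK hne hv).trans (le_csSup hbdd ⟨v, hv, rfl⟩)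
      · have hu : x - y ≠ 0 := sub_ne_zero.2 hxy
        have h := inner_sub_le_breadth hK hu hx hy
        rw [real_inner_self_eq_norm_sq, sq] at h
        rw [dist_eq_norm]
        exact (le_of_mul_le_mul_left h (norm_pos_iff.2 hu)).trans (le_csSup hbdd ⟨_, hu, rfl⟩)

theorem width_le_breadth {K : Set Plane} (hK : IsCompact K) (hne : K.Nonempty) {u : Plane}
    (hu : u ≠ 0) : width K unitDisk ≤ breadth K unitDisk u :=
  csInf_le ⟨0, by rintro _ ⟨v, hv, rfl⟩; exact breadth_nonneg hK hne hv⟩ ⟨u, hu, rfl⟩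

theorem le_width {K : Set Plane} {b : ℝ} (h : ∀ u : Plane, u ≠ 0 → b ≤ breadth K unitDisk u) :
    b ≤ width K unitDisk := by
  obtain ⟨v, hv⟩ := exists_ne (0 : Plane)
  refine le_csInf ⟨_, v, hv, rfl⟩ ?_
  rintro _ ⟨u, hu, rfl⟩
  exact h u hu

theorem inner_self_div_norm {u : Plane} (hu : u ≠ 0) (r : ℝ) :
    inner ℝ u ((r / ‖u‖) • u) = r * ‖u‖ := by
  have hu' : ‖u‖ ≠ 0 := norm_ne_zero_iff.2 hu
  rw [inner_smul_right, real_inner_self_eq_norm_sq]; field_simp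

theorem norm_div_norm_smul {u : Plane} (hu : u ≠ 0) {r : ℝ} (hr : 0 ≤ r) :
    ‖(r / ‖u‖) • u‖ = r := by
  have hu' : ‖u‖ ≠ 0 := norm_ne_zero_iff.2 hu
  rw [norm_smul, norm_div, norm_norm, Real.norm_of_nonneg hr, div_mul_cancel₀ _ hu']

theorem add_smul_mem_closedBall (c : Plane) {u : Plane} (hu : u ≠ 0) {r : ℝ} (hr : 0 ≤ r) :
    c + (r / ‖u‖) • u ∈ Metric.closedBall c r := by
  rw [mem_closedBall_iff_norm, add_sub_cancel_left, norm_div_norm_smul hu hr]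

theorem two_mul_le_breadth {K : Set Plane} (hK : IsCompact K) {c : Plane} {r : ℝ} (hr : 0 ≤ r)
    (h : Metric.closedBall c r ⊆ K) {u : Plane} (hu : u ≠ 0) : 2 * r ≤ breadth K unitDisk u := by
  have hu' : 0 < ‖u‖ := norm_pos_iff.2 hu
  have h1 := h (add_smul_mem_closedBall c hu hr)
  have h2 := h (add_smul_mem_closedBall c (neg_ne_zero.2 hu) hr)
  have h3 := inner_sub_le_breadth hK hu h1 h2
  rw [norm_neg, smul_neg, add_sub_add_left_eq_sub, sub_neg_eq_add, inner_add_right,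
    inner_self_div_norm hu] at h3
  refine le_of_mul_le_mul_left ?_ hu'
  linarith

theorem circumradius_le {K : Set Plane} {c : Plane} {R : ℝ} (hR : 0 < R)
    (h : K ⊆ Metric.closedBall c R) : circumradius K unitDisk ≤ R :=
  csInf_le ⟨0, fun _ hx => hx.1.le⟩ ⟨hR, c, by rwa [vadd_smul_unitDisk c hR.le]⟩

theorem two_mul_le_width {K : Set Plane} (hK : IsCompact K) {c : Plane} {r : ℝ} (hr : 0 ≤ r)
    (h : Metric.closedBall c r ⊆ K) : 2 * r ≤ width K unitDisk :=
  le_width fun _ hu => two_mul_le_breadth hK hr h hu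

theorem bddAbove_inradius {K : Set Plane} (hK : IsCompact K) :
    BddAbove {ρ : ℝ | 0 < ρ ∧ ∃ t : Plane, t +ᵥ (ρ • unitDisk) ⊆ K} := by
  refine ⟨width K unitDisk / 2, ?_⟩
  rintro ρ ⟨hρ, t, ht⟩
  rw [vadd_smul_unitDisk t hρ.le] at ht
  linarith [two_mul_le_width hK hρ.le ht]

theorem le_inradius {K : Set Plane} (hK : IsCompact K) {c : Plane} {r : ℝ} (hr : 0 < r)
    (h : Metric.closedBall c r ⊆ K) : r ≤ inradius K unitDisk :=
  le_csSup (bddAbove_inradius hK) ⟨hr, c, by rwa [vadd_smul_unitDisk c hr.le]⟩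

/-! ### Inball, circumball and contact points. -/

/-- The inradius of a body is positive and attained. -/
theorem exists_inball {K : Set Plane} (hK : IsBody K) :
    0 < inradius K unitDisk ∧ ∃ c ∈ K, Metric.closedBall c (inradius K unitDisk) ⊆ K := by
  obtain ⟨-, hc, ⟨z, hz⟩⟩ := hK
  obtain ⟨ε, hε, hball⟩ := Metric.nhds_basis_closedBall.mem_iff.1 (mem_interior_iff_mem_nhds.1 hz)
  have hpos : 0 < inradius K unitDisk := hε.trans_le (le_inradius hc hε hball)
  refine ⟨hpos, ?_⟩
  have hne : Kᶜ.Nonempty := by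
    rw [Set.nonempty_compl]
    rintro rfl
    exact noncompact_univ Plane hc
  -- An incentre is a point of `K` farthest from the complement.
  obtain ⟨c, hcK, hmax⟩ := hc.exists_isMaxOn ⟨z, interior_subset hz⟩
    (Metric.continuous_infDist_pt Kᶜ).continuousOn
  have hle : inradius K unitDisk ≤ Metric.infDist c Kᶜ := by
    refine csSup_le ⟨ε, hε, z, by rwa [vadd_smul_unitDisk z hε.le]⟩ ?_
    rintro ρ ⟨hρ, t, ht⟩
    rw [vadd_smul_unitDisk t hρ.le] at ht
    refine le_trans ?_ (hmax (ht (Metric.mem_closedBall_self hρ.le)))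
    refine (Metric.le_infDist hne).2 fun y hy => ?_
    by_contra! h
    exact hy (ht (by rw [Metric.mem_closedBall, dist_comm]; exact h.le))
  refine ⟨c, hcK, ?_⟩
  calc Metric.closedBall c (inradius K unitDisk) ⊆ Metric.closedBall c (Metric.infDist c Kᶜ) :=
        Metric.closedBall_subset_closedBall hle
    _ = closure (Metric.ball c (Metric.infDist c Kᶜ)) :=
        (closure_ball c (hpos.trans_le hle).ne').symm
    _ ⊆ K := closure_minimal
        (Set.disjoint_compl_right_iff_subset.1 Metric.disjoint_ball_infDist) hc.isClosed

/-- A body containing a disk of radius `r` about `c` lies in the disk of radius `D - r` about `c`. -/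
theorem subset_closedBall_diam_sub {K : Set Plane} (hK : IsCompact K) {c : Plane} {r : ℝ}
    (hr : 0 ≤ r) (h : Metric.closedBall c r ⊆ K) :
    K ⊆ Metric.closedBall c (Metric.diam K - r) := by
  intro x hx
  rw [mem_closedBall_iff_norm]
  obtain ⟨v, hv⟩ := exists_ne (0 : Plane)
  rcases eq_or_ne x c with rfl | hxc
  · have h1 := Metric.dist_le_diam_of_mem hK.isBounded (h (add_smul_mem_closedBall x hv hr)) hx
    rw [dist_eq_norm, add_sub_cancel_left, norm_div_norm_smul hv hr] at h1
    simpa using h1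
  · have hu : x - c ≠ 0 := sub_ne_zero.2 hxc
    have hu' : 0 < ‖x - c‖ := norm_pos_iff.2 hu
    -- Compare `x` with the point of the disk diametrically opposite to its direction from `c`.
    have h1 := Metric.dist_le_diam_of_mem hK.isBounded hx
      (h (add_smul_mem_closedBall c (neg_ne_zero.2 hu) hr))
    have e : x - (c + (r / ‖-(x - c)‖) • -(x - c)) = (1 + r / ‖x - c‖) • (x - c) := by
      rw [norm_neg]; module
    rw [dist_eq_norm, e, norm_smul, Real.norm_of_nonneg (by positivity), add_mul,
      div_mul_cancel₀ _ hu'.ne'] at h1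
    linarith

/-- Carathéodory in the plane; if fewer than three points occur, one is repeated with weight `0`. -/
theorem exists_three_of_mem_convexHull {s : Set Plane} {x : Plane} (hx : x ∈ convexHull ℝ s) :
    ∃ p ∈ s, ∃ q ∈ s, ∃ t ∈ s, ∃ a b c : ℝ, 0 ≤ a ∧ 0 ≤ b ∧ 0 ≤ c ∧ a + b + c = 1 ∧
      a • p + b • q + c • t = x := by
  obtain ⟨ι, hι, z, w, hz, hind, hw, hw1, hwz⟩ := eq_pos_convex_span_of_mem_convexHull hx
  have hzs : ∀ i, z i ∈ s := fun i => hz ⟨i, rfl⟩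
  have hcard : Fintype.card ι ≤ 3 := by
    have := hind.card_le_finrank_succ
    have h2 := Submodule.finrank_le (vectorSpan ℝ (Set.range z))
    rw [finrank_euclideanSpace_fin] at h2
    omega
  obtain ⟨k, hk⟩ : ∃ k, Fintype.card ι = k := ⟨_, rfl⟩
  obtain ⟨e⟩ : Nonempty (Fin k ≃ ι) := ⟨(Fintype.equivFinOfCardEq hk).symm⟩
  rw [← e.sum_comp] at hw1 hwz
  rw [hk] at hcard
  clear hk
  interval_cases k
  · simp at hw1
  · refine ⟨_, hzs (e 0), _, hzs (e 0), _, hzs (e 0), w (e 0), 0, 0, (hw _).le, le_rfl, le_rfl, ?_, ?_⟩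
    · simpa using hw1
    · simpa using hwz
  · refine ⟨_, hzs (e 0), _, hzs (e 1), _, hzs (e 1), w (e 0), w (e 1), 0, (hw _).le, (hw _).le,
      le_rfl, ?_, ?_⟩
    · simpa [Fin.sum_univ_two] using hw1
    · simpa [Fin.sum_univ_two] using hwz
  · refine ⟨_, hzs (e 0), _, hzs (e 1), _, hzs (e 2), w (e 0), w (e 1), w (e 2), (hw _).le,
      (hw _).le, (hw _).le, ?_, ?_⟩
    · simpa [Fin.sum_univ_three] using hw1
    · simpa [Fin.sum_univ_three] using hwz

theorem isCompact_convexHull {s : Set Plane} (hs : IsCompact s) : IsCompact (convexHull ℝ s) := by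
  have hC : IsCompact ((s ×ˢ s ×ˢ s) ×ˢ stdSimplex ℝ (Fin 3)) :=
    (hs.prod (hs.prod hs)).prod (isCompact_stdSimplex ℝ (Fin 3))
  have hf : Continuous fun z : (Plane × Plane × Plane) × (Fin 3 → ℝ) =>
      z.2 0 • z.1.1 + z.2 1 • z.1.2.1 + z.2 2 • z.1.2.2 := by fun_prop
  convert hC.image hf using 1
  ext x
  constructor
  · intro hx
    obtain ⟨p, hp, q, hq, t, ht, a, b, c, ha, hb, hc, habc, rfl⟩ := exists_three_of_mem_convexHull hx
    refine ⟨((p, q, t), ![a, b, c]), ⟨⟨hp, hq, ht⟩, ?_, ?_⟩, rfl⟩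
    · intro i; fin_cases i <;> assumption
    · simpa [Fin.sum_univ_three] using habc
  · rintro ⟨⟨⟨p, q, t⟩, w⟩, ⟨⟨hp, hq, ht⟩, hw, hw1⟩, rfl⟩
    have := (convex_convexHull ℝ s).sum_mem (t := Finset.univ) (w := w) (z := ![p, q, t])
      (fun i _ => hw i) hw1 (by
        intro i _
        fin_cases i <;> apply subset_convexHull ℝ s <;> assumption)
    simpa [Fin.sum_univ_three] using this

/-- If `K` lies in a disk of radius equal to its circumradius, its contact points with the bounding
circle balance the centre. -/
theorem center_mem_convexHull {K : Set Plane} (hK : IsCompact K) (hne : K.Nonempty) {c : Plane}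
    {R : ℝ} (hR : 0 < R) (h : K ⊆ Metric.closedBall c R) (hRK : R ≤ circumradius K unitDisk) :
    c ∈ convexHull ℝ (K ∩ Metric.sphere c R) := by
  by_contra hc
  have hP : IsCompact (K ∩ Metric.sphere c R) := hK.inter_right Metric.isClosed_sphere
  obtain ⟨f, a, hfc, hfP⟩ := geometric_hahn_banach_point_closed (convex_convexHull ℝ _)
    (isCompact_convexHull hP).isClosed hc
  let v : Plane := (InnerProductSpace.toDual ℝ Plane).symm f
  have hv : ∀ x, inner ℝ v x = f x := fun x => InnerProductSpace.toDual_symm_apply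
  -- Moving the centre slightly along `v` should shrink the ball. The positive minimum `φ` of this
  -- function says that each point of `K` is either at depth `φ` inside the circle or has component
  -- at least `φ` along `v`.
  have hcont : Continuous fun x => max (R - ‖x - c‖) (inner ℝ v (x - c)) := by fun_prop
  obtain ⟨z, hz, hmin⟩ := hK.exists_isMinOn hne hcont.continuousOn
  set φ := max (R - ‖z - c‖) (inner ℝ v (z - c)) with hφ
  have hφ0 : 0 < φ := by
    rw [hφ, lt_max_iff]
    rcases lt_or_eq_of_le (mem_closedBall_iff_norm.1 (h hz)) with h1 | h1
    · left; linarith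
    · right
      have := hfP z (subset_convexHull ℝ _ ⟨hz, mem_sphere_iff_norm.2 h1⟩)
      rw [hv, map_sub]; linarith
  -- The first bound keeps `-2 ε φ + ε² ‖v‖²` negative for points with a large component; the second
  -- keeps deep points inside.
  obtain ⟨ε, hε, hε1, hε2⟩ : ∃ ε : ℝ, 0 < ε ∧ ε * ‖v‖ ^ 2 ≤ φ ∧ ε * ‖v‖ ≤ φ / 2 := by
    refine ⟨min (φ / (‖v‖ ^ 2 + 1)) (φ / 2 / (‖v‖ + 1)), by positivity, ?_, ?_⟩
    · calc _ ≤ φ / (‖v‖ ^ 2 + 1) * (‖v‖ ^ 2 + 1) :=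
            mul_le_mul (min_le_left _ _) (by linarith) (by positivity) (by positivity)
        _ = φ := div_mul_cancel₀ _ (by positivity)
    · calc _ ≤ φ / 2 / (‖v‖ + 1) * (‖v‖ + 1) :=
            mul_le_mul (min_le_right _ _) (by linarith) (by positivity) (by positivity)
        _ = φ / 2 := div_mul_cancel₀ _ (by positivity)
  obtain ⟨x, hx, hxmax⟩ := hK.exists_isMaxOn hne
    (f := fun x => ‖x - (c + ε • v)‖) (by fun_prop)
  have hmin' : ∀ y ∈ K, φ ≤ max (R - ‖y - c‖) (inner ℝ v (y - c)) := fun y hy => hmin hy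
  have hlt : ‖x - (c + ε • v)‖ < R := by
    rcases le_max_iff.1 (hmin' x hx) with h1 | h1
    · have : ‖x - (c + ε • v)‖ ≤ ‖x - c‖ + ε * ‖v‖ := by
        rw [← sub_sub]
        refine (norm_sub_le _ _).trans ?_
        rw [norm_smul, Real.norm_of_nonneg hε.le]
      linarith
    · refine lt_of_pow_lt_pow_left₀ 2 hR.le ?_
      have h2 : ‖x - c‖ ^ 2 ≤ R ^ 2 :=
        pow_le_pow_left₀ (norm_nonneg _) (mem_closedBall_iff_norm.1 (h hx)) 2
      rw [← sub_sub, norm_sub_sq_real, inner_smul_right, real_inner_comm, norm_smul,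
        Real.norm_of_nonneg hε.le, mul_pow]
      have h3 := mul_le_mul_of_nonneg_left h1 hε.le
      have h4 := mul_le_mul_of_nonneg_left hε1 hε.le
      have h5 := mul_pos hε hφ0
      linarith
  obtain ⟨R', hR'1, hR'2⟩ := exists_between (max_lt hlt hR)
  have := circumradius_le (K := K) (c := c + ε • v) ((le_max_right _ _).trans_lt hR'1) fun y hy =>
    mem_closedBall_iff_norm.2 ((hxmax hy).trans ((le_max_left _ _).trans hR'1.le))
  linarith

/-! ### The upper bound. -/

theorem diameter_le_breadth {K : Set Plane} (hK : IsPseudoComplete K unitDisk) {u : Plane}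
    (hu : u ≠ 0) :
    diameter K unitDisk * (2 * rConst) ≤ breadth K unitDisk u * (1 + rConst) := by
  obtain ⟨hbody, hpc⟩ := hK
  obtain ⟨hr, c, hcK, hball⟩ := exists_inball hbody
  have hKc : IsCompact K := hbody.2.1
  have hne : K.Nonempty := ⟨c, hcK⟩
  have hsub := subset_closedBall_diam_sub hKc hr.le hball
  have hdist : ∀ x ∈ K, ∀ y ∈ K, dist x y ≤ diameter K unitDisk := by
    intro x hx y hy
    rw [diameter_eq_diam hKc hne]
    exact Metric.dist_le_diam_of_mem hKc.isBounded hx hy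
  rw [← diameter_eq_diam hKc hne, ← hpc, add_sub_cancel_left] at hsub
  rw [← hpc] at hdist ⊢
  set r := inradius K unitDisk with hr_def
  set R := circumradius K unitDisk with hR_def
  set b := breadth K unitDisk u with hb_def
  have hrR : r ≤ R := by
    have := hsub (hball (add_smul_mem_closedBall c hu hr.le))
    rwa [mem_closedBall_iff_norm, add_sub_cancel_left, norm_div_norm_smul hu hr.le] at this
  have hR : 0 < R := hr.trans_le hrR
  obtain ⟨hb1, hb2⟩ := rConst_bounds
  rcases le_or_gt (rConst * R) r with hlarge | hsmall
  · have h2r : 2 * r ≤ b := two_mul_le_breadth hKc hr.le hball hu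
    have := mul_le_mul_of_nonneg_right h2r (show 0 ≤ 1 + rConst by linarith)
    linarith
  obtain ⟨p, hp, q, hq, s, hs, α, β, γ, hα, hβ, hγ, hsum, hcomb⟩ :=
    exists_three_of_mem_convexHull (center_mem_convexHull hKc hne hR hsub le_rfl)
  set v := (1 / ‖u‖) • u with hv
  have hv1 : ‖v‖ = 1 := norm_div_norm_smul hu zero_le_one
  have hv0 : v ≠ 0 := norm_ne_zero_iff.1 (by rw [hv1]; exact one_ne_zero)
  have hvb : ∀ x ∈ K, ∀ y ∈ K, inner ℝ v x - inner ℝ v y ≤ b := by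
    intro x hx y hy
    have hu' : 0 < ‖u‖ := norm_pos_iff.2 hu
    rw [← inner_sub_right, hv, real_inner_smul_left, one_div, inv_mul_le_iff₀ hu']
    exact inner_sub_le_breadth hKc hu hx hy
  obtain ⟨x, hx, hmax⟩ := hKc.exists_isMaxOn hne (f := fun x => inner ℝ v x) (by fun_prop)
  obtain ⟨y, hy, hmin⟩ := hKc.exists_isMinOn hne (f := fun x => inner ℝ v x) (by fun_prop)
  have hmax' : ∀ z ∈ K, inner ℝ v z ≤ inner ℝ v x := fun z hz => hmax hz
  have hmin' : ∀ z ∈ K, inner ℝ v y ≤ inner ℝ v z := fun z hz => hmin hz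
  have hin : ∀ z, inner ℝ v (R⁻¹ • (z - c)) = (inner ℝ v z - inner ℝ v c) / R := by
    intro z; rw [inner_smul_right, inner_sub_right]; ring
  have hnorm : ∀ z ∈ Metric.sphere c R, ‖R⁻¹ • (z - c)‖ = 1 := by
    intro z hz
    rw [norm_smul, mem_sphere_iff_norm.1 hz, Real.norm_of_nonneg (by positivity),
      inv_mul_cancel₀ hR.ne']
  have hscale : ∀ z ∈ K, ∀ w ∈ K, dist (R⁻¹ • (z - c)) (R⁻¹ • (w - c)) ≤ 1 + r / R := by
    intro z hz w hw
    rw [dist_smul₀, dist_sub_right, Real.norm_of_nonneg (by positivity), inv_mul_le_iff₀ hR]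
    calc dist z w ≤ r + R := hdist z hz w hw
      _ = R * (1 + r / R) := by field_simp; ring
  have hx' : r ≤ inner ℝ v x - inner ℝ v c := by
    have := hmax' _ (hball (add_smul_mem_closedBall c hv0 hr.le))
    rw [inner_add_right, inner_self_div_norm hv0, hv1] at this
    linarith
  have hy' : r ≤ inner ℝ v c - inner ℝ v y := by
    have := hmin' _ (hball (add_smul_mem_closedBall c (neg_ne_zero.2 hv0) hr.le))
    rw [inner_add_right, norm_neg, smul_neg, inner_neg_right, inner_self_div_norm hv0, hv1] at this
    linarith
  have up : ∀ z ∈ K, inner ℝ v (R⁻¹ • (z - c)) ≤ (inner ℝ v x - inner ℝ v c) / R := by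
    intro z hz
    rw [hin]
    gcongr
    exact hmax' z hz
  have low : ∀ z ∈ K, -((inner ℝ v c - inner ℝ v y) / R) ≤ inner ℝ v (R⁻¹ • (z - c)) := by
    intro z hz
    rw [hin, ← neg_div, neg_sub]
    gcongr
    exact hmin' z hz
  have hzero : α • R⁻¹ • (p - c) + β • R⁻¹ • (q - c) + γ • R⁻¹ • (s - c) = 0 := by
    have e : α • R⁻¹ • (p - c) + β • R⁻¹ • (q - c) + γ • R⁻¹ • (s - c)
        = R⁻¹ • ((α • p + β • q + γ • s) - (α + β + γ) • c) := by module
    rw [e, hcomb, hsum, one_smul, sub_self, smul_zero]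
  -- The strip is the one supporting `K` itself, so its distances from `c` are at least `r` because
  -- the inball touches or stays inside it.
  have key := two_rConst_le_of_strip (div_pos hr hR) ((div_lt_iff₀ hR).2 hsmall)
    (div_le_div_of_nonneg_right hx' hR.le) (div_le_div_of_nonneg_right hy' hR.le) hv1
    hα hβ hγ hsum (hnorm p hp.2) (hnorm q hq.2) (hnorm s hs.2) hzero
    (hscale p hp.1 q hq.1) (hscale p hp.1 s hs.1) (hscale q hq.1 s hs.1)
    (up p hp.1) (low p hp.1) (up q hq.1) (low q hq.1) (up s hs.1) (low s hs.1)
  rw [← add_div, le_div_iff₀ hR] at key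
  have hb : 2 * rConst * R ≤ b := by linarith [hvb x hx y hy]
  calc (r + R) * (2 * rConst) ≤ (rConst * R + R) * (2 * rConst) := by gcongr
    _ = 2 * rConst * R * (1 + rConst) := by ring
    _ ≤ b * (1 + rConst) := by gcongr

theorem diameter_div_width_le {K : Set Plane} (hK : IsPseudoComplete K unitDisk) :
    diameter K unitDisk / width K unitDisk ≤ (1 / 2 : ℝ) * (1 + 1 / rConst) := by
  have hr0 : 0 < rConst := by linarith [rConst_bounds.1]
  obtain ⟨hr, c, -, hball⟩ := exists_inball hK.1
  have hw : 0 < width K unitDisk :=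
    (mul_pos two_pos hr).trans_le (two_mul_le_width hK.1.2.1 hr.le hball)
  have h : diameter K unitDisk * (2 * rConst) / (1 + rConst) ≤ width K unitDisk :=
    le_width fun u hu => by
      rw [div_le_iff₀ (by positivity)]
      exact diameter_le_breadth hK hu
  rw [div_le_iff₀ (by positivity)] at h
  rw [div_le_iff₀ hw]
  have e : (1 / 2 : ℝ) * (1 + 1 / rConst) * width K unitDisk
      = width K unitDisk * (1 + rConst) / (2 * rConst) := by field_simp; ring
  rwa [e, le_div_iff₀ (by positivity)]

/-! ### The hood attains equality. -/

/-- A disk-to-disk certificate for pseudo-completeness together with the value of `D / w`. -/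
theorem isPseudoComplete_of_concentric {K : Set Plane} (hconv : Convex ℝ K) (hK : IsCompact K)
    {z u : Plane} {r R : ℝ} (hr : 0 < r) (hin : Metric.closedBall z r ⊆ K)
    (hout : ∀ t ρ, K ⊆ Metric.closedBall t ρ → R ≤ ρ) (hR : 0 < R) (hKR : K ⊆ Metric.closedBall z R)
    (hd : Metric.diam K = r + R) (hu : u ≠ 0)
    (hub : ∀ x ∈ K, ∀ y ∈ K, inner ℝ u (x - y) ≤ ‖u‖ * (2 * r)) :
    IsPseudoComplete K unitDisk ∧ diameter K unitDisk / width K unitDisk = (r + R) / (2 * r) := by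
  have hne : K.Nonempty := ⟨z, hin (Metric.mem_closedBall_self hr.le)⟩
  have hbody : IsBody K := ⟨hconv, hK, z, mem_interior_iff_mem_nhds.2
    (Filter.mem_of_superset (Metric.closedBall_mem_nhds z hr) hin)⟩
  have hw : width K unitDisk = 2 * r :=
    le_antisymm ((width_le_breadth hK hne hu).trans (breadth_le hne hu hub))
      (two_mul_le_width hK hr.le hin)
  have hinr : inradius K unitDisk = r := by
    refine le_antisymm ?_ (le_inradius hK hr hin)
    obtain ⟨h0, c, -, hc⟩ := exists_inball hbody
    linarith [two_mul_le_width hK h0.le hc]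
  have hcirc : circumradius K unitDisk = R := by
    refine le_antisymm (circumradius_le hR hKR) ?_
    refine le_csInf ⟨R, hR, z, by rwa [vadd_smul_unitDisk z hR.le]⟩ ?_
    rintro ρ ⟨hρ, t, ht⟩
    exact hout t ρ (by rwa [vadd_smul_unitDisk t hρ.le] at ht)
  have hdiam := (diameter_eq_diam hK hne).trans hd
  exact ⟨⟨hbody, by rw [hinr, hcirc, hdiam]⟩, by rw [hdiam, hw]⟩

theorem rConst_pos : 0 < rConst := by linarith [rConst_bounds.1]

theorem rConst_lt_one : rConst < 1 := by linarith [rConst_bounds.2]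

/-- The points spanning the hood. -/
def hoodGenerators : Set Plane :=
  {!₂[0, 1], !₂[rConst, -√(1 - rConst ^ 2)], !₂[-rConst, -√(1 - rConst ^ 2)]} ∪
    Metric.closedBall 0 rConst

theorem hood_eq : hood = convexHull ℝ hoodGenerators := by
  rw [hood, hoodGenerators, unitDisk, smul_unitClosedBall, Real.norm_of_nonneg rConst_pos.le]

theorem isCompact_hood : IsCompact hood := by
  rw [hood_eq]
  exact isCompact_convexHull (((Set.finite_singleton _).insert _).insert _ |>.isCompact.union
    (isCompact_closedBall _ _))

theorem closedBall_subset_hood : Metric.closedBall 0 rConst ⊆ hood := by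
  rw [hood_eq]
  exact Set.subset_union_right.trans (subset_convexHull ℝ _)

theorem sqrt_sq_one_sub_rConst_sq : √(1 - rConst ^ 2) ^ 2 = 1 - rConst ^ 2 :=
  Real.sq_sqrt (by nlinarith [rConst_pos, rConst_lt_one])

theorem norm_apex : ‖(!₂[0, 1] : Plane)‖ = 1 := by
  simp [EuclideanSpace.norm_eq, Fin.sum_univ_two]

theorem norm_right_foot : ‖(!₂[rConst, -√(1 - rConst ^ 2)] : Plane)‖ = 1 := by
  simp [EuclideanSpace.norm_eq, Fin.sum_univ_two, sqrt_sq_one_sub_rConst_sq]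

theorem norm_left_foot : ‖(!₂[-rConst, -√(1 - rConst ^ 2)] : Plane)‖ = 1 := by
  simp [EuclideanSpace.norm_eq, Fin.sum_univ_two, sqrt_sq_one_sub_rConst_sq]

theorem hood_subset_closedBall : hood ⊆ Metric.closedBall 0 1 := by
  rw [hood_eq]
  refine convexHull_min (Set.union_subset ?_
    (Metric.closedBall_subset_closedBall rConst_lt_one.le)) (convex_closedBall _ _)
  rintro x (rfl | rfl | rfl) <;> rw [mem_closedBall_zero_iff]
  exacts [norm_apex.le, norm_right_foot.le, norm_left_foot.le]

theorem abs_apply_zero_le_of_mem_hood {x : Plane} (hx : x ∈ hood) : |x 0| ≤ rConst := by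
  rw [hood_eq] at hx
  have hconv : Convex ℝ {x : Plane | |x 0| ≤ rConst} := by
    have : {x : Plane | |x 0| ≤ rConst}
        = (EuclideanSpace.proj (0 : Fin 2) : Plane →L[ℝ] ℝ) ⁻¹' Set.Icc (-rConst) rConst := by
      ext x; simp [abs_le]
    rw [this]
    exact (convex_Icc _ _).linear_preimage (EuclideanSpace.proj (0 : Fin 2) : Plane →L[ℝ] ℝ).toLinearMap
  refine convexHull_min ?_ hconv hx
  rintro y ((rfl | rfl | rfl) | hy)
  · simp [rConst_pos.le]
  · simp [abs_of_pos rConst_pos]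
  · simp [abs_of_pos rConst_pos]
  · exact (PiLp.norm_apply_le y 0).trans (mem_closedBall_zero_iff.1 hy)

theorem dist_apex_right_foot :
    dist (!₂[0, 1] : Plane) !₂[rConst, -√(1 - rConst ^ 2)] = 1 + rConst := by
  rw [EuclideanSpace.dist_eq, Real.sqrt_eq_iff_mul_self_eq_of_pos (by linarith [rConst_pos])]
  simp [Fin.sum_univ_two, Real.dist_eq, sq_abs]
  nlinarith [sqrt_sq_one_sub_rConst_sq, sqrt_one_sub_rConst_sq]

theorem dist_apex_left_foot :
    dist (!₂[0, 1] : Plane) !₂[-rConst, -√(1 - rConst ^ 2)] = 1 + rConst := by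
  rw [← dist_apex_right_foot, EuclideanSpace.dist_eq, EuclideanSpace.dist_eq]
  simp [Fin.sum_univ_two, Real.dist_eq, sq_abs]

theorem dist_feet :
    dist (!₂[rConst, -√(1 - rConst ^ 2)] : Plane) !₂[-rConst, -√(1 - rConst ^ 2)]
      = 2 * rConst := by
  rw [EuclideanSpace.dist_eq, Real.sqrt_eq_iff_mul_self_eq_of_pos (by linarith [rConst_pos])]
  simp [Fin.sum_univ_two, Real.dist_eq, sq_abs]
  ring

theorem diam_hood : Metric.diam hood = rConst + 1 := by
  have h0 := rConst_pos
  have h1 := rConst_lt_one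
  apply le_antisymm
  · rw [hood_eq, convexHull_diam]
    have hn : ∀ x y : Plane, ‖x‖ ≤ 1 → ‖y‖ ≤ rConst → dist x y ≤ rConst + 1 := by
      intro x y hx hy
      rw [dist_eq_norm]
      linarith [norm_sub_le x y]
    refine Metric.diam_le_of_forall_dist_le (by linarith) ?_
    rintro x (hx | hx) y (hy | hy)
    · rcases hx with rfl | rfl | rfl <;> rcases hy with rfl | rfl | rfl
      · rw [dist_self]; linarith
      · rw [dist_apex_right_foot, add_comm]
      · rw [dist_apex_left_foot, add_comm]
      · rw [dist_comm, dist_apex_right_foot, add_comm]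
      · rw [dist_self]; linarith
      · rw [dist_feet]; linarith
      · rw [dist_comm, dist_apex_left_foot, add_comm]
      · rw [dist_comm, dist_feet]; linarith
      · rw [dist_self]; linarith
    · refine hn x y ?_ (mem_closedBall_zero_iff.1 hy)
      rcases hx with rfl | rfl | rfl
      exacts [norm_apex.le, norm_right_foot.le, norm_left_foot.le]
    · rw [dist_comm]
      refine hn y x ?_ (mem_closedBall_zero_iff.1 hx)
      rcases hy with rfl | rfl | rfl
      exacts [norm_apex.le, norm_right_foot.le, norm_left_foot.le]
    · exact hn x y ((mem_closedBall_zero_iff.1 hx).trans h1.le) (mem_closedBall_zero_iff.1 hy)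
  · rw [add_comm, ← dist_apex_right_foot]
    refine Metric.dist_le_diam_of_mem isCompact_hood.isBounded ?_ ?_ <;> rw [hood_eq] <;>
      apply subset_convexHull <;> left <;> simp

theorem one_le_of_hood_subset {t : Plane} {ρ : ℝ} (h : hood ⊆ Metric.closedBall t ρ) : 1 ≤ ρ := by
  have hmem : ∀ x ∈ ({!₂[0, 1], !₂[rConst, -√(1 - rConst ^ 2)], !₂[-rConst, -√(1 - rConst ^ 2)]} :
      Set Plane), dist x t ^ 2 ≤ ρ ^ 2 := fun x hx =>
    pow_le_pow_left₀ dist_nonneg (h (by rw [hood_eq]; exact subset_convexHull ℝ _ (Or.inl hx))) 2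
  have hρ : 0 ≤ ρ := dist_nonneg.trans (h (closedBall_subset_hood
    (Metric.mem_closedBall_self rConst_pos.le)))
  have e1 := hmem !₂[0, 1] (by simp)
  have e2 := hmem !₂[rConst, -√(1 - rConst ^ 2)] (by simp)
  have e3 := hmem !₂[-rConst, -√(1 - rConst ^ 2)] (by simp)
  rw [EuclideanSpace.dist_eq, Real.sq_sqrt (by positivity)] at e1 e2 e3
  simp only [Fin.sum_univ_two, Real.dist_eq, sq_abs] at e1 e2 e3
  simp at e1 e2 e3
  have hs := sqrt_sq_one_sub_rConst_sq
  have hs0 := Real.sqrt_nonneg (1 - rConst ^ 2)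
  set m := √(1 - rConst ^ 2)
  -- Weights `2 m, 1, 1` on apex and feet balance at the origin, so the linear terms in `t` cancel.
  have : (2 * m + 2) * (1 + t 0 ^ 2 + t 1 ^ 2) ≤ (2 * m + 2) * ρ ^ 2 := by
    have := mul_le_mul_of_nonneg_left e1 (mul_nonneg zero_le_two hs0)
    nlinarith
  have := le_of_mul_le_mul_left this (by positivity)
  have h1 : 1 ^ 2 ≤ ρ ^ 2 := by linarith [sq_nonneg (t 0), sq_nonneg (t 1)]
  exact (pow_le_pow_iff_left₀ zero_le_one hρ two_ne_zero).1 h1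

theorem isPseudoComplete_of_isHood {K : Set Plane} (hK : IsHood K) :
    IsPseudoComplete K unitDisk ∧
      diameter K unitDisk / width K unitDisk = (1 / 2 : ℝ) * (1 + 1 / rConst) := by
  obtain ⟨c, e, hc, rfl⟩ := hK
  have h0 := rConst_pos
  have himage : ∀ (x : Plane) (ρ : ℝ), c • (e '' Metric.closedBall x ρ)
      = Metric.closedBall (c • e x) (c * ρ) := by
    intro x ρ
    rw [e.image_closedBall, smul_closedBall' hc.ne', Real.norm_of_nonneg hc.le]
  -- Mazur–Ulam: the isometry is affine. Its linear part `L` carries the hood's narrowest direction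
  -- `v` to that of the image.
  let A := e.toRealAffineIsometryEquiv
  have hA : ∀ x, A x = e x := fun x => by rw [e.coeFn_toRealAffineIsometryEquiv]
  let L := A.linearIsometryEquiv
  let v : Plane := EuclideanSpace.single 0 1
  have hv : ‖v‖ = 1 := by simp [v]
  have hLv : ‖L v‖ = 1 := by rw [L.norm_map, hv]
  have hconv : Convex ℝ (e '' hood) := by
    have : e '' hood = A.toAffineEquiv.toAffineMap '' hood := by
      ext x; simp [hA]
    rw [this]
    exact (convex_convexHull ℝ _).affine_image _
  obtain ⟨hpc, hq⟩ := isPseudoComplete_of_concentric (K := c • (e '' hood)) (z := c • e 0) (u := L v)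
    (r := c * rConst) (R := c * 1) (hconv.smul c) ((isCompact_hood.image e.continuous).smul c)
    (by positivity)
    (by rw [← himage]; exact Set.smul_set_mono (Set.image_mono closedBall_subset_hood))
    (by
      intro t ρ h
      have : hood ⊆ Metric.closedBall (e.symm (c⁻¹ • t)) (ρ / c) := by
        intro x hx
        have h1 := h (Set.smul_mem_smul_set (Set.mem_image_of_mem e hx))
        have h2 : dist (c • e x) t = c * dist x (e.symm (c⁻¹ • t)) := by
          rw [← e.dist_eq x, e.apply_symm_apply, ← Real.norm_of_nonneg hc.le, ← dist_smul₀,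
            Real.norm_of_nonneg hc.le, smul_inv_smul₀ hc.ne']
        rw [Metric.mem_closedBall, h2] at h1
        rw [Metric.mem_closedBall, le_div_iff₀ hc, mul_comm]
        exact h1
      have h3 := one_le_of_hood_subset this
      rwa [le_div_iff₀ hc, mul_comm] at h3)
    (by positivity)
    (by rw [← himage]; exact Set.smul_set_mono (Set.image_mono hood_subset_closedBall))
    (by rw [diam_smul₀, e.diam_image, diam_hood, Real.norm_of_nonneg hc.le, mul_add])
    (norm_ne_zero_iff.1 (by rw [hLv]; exact one_ne_zero))
    (by
      rintro _ ⟨_, ⟨x, hx, rfl⟩, rfl⟩ _ ⟨_, ⟨y, hy, rfl⟩, rfl⟩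
      have h1 : e x - e y = L (x - y) := by
        rw [← hA, ← hA]; exact (A.map_vsub x y).symm
      have h2 : inner ℝ v (x - y) = x 0 - y 0 := by simp [v, EuclideanSpace.inner_single_left]
      change inner ℝ (L v) (c • e x - c • e y) ≤ _
      rw [← smul_sub, inner_smul_right, h1, L.inner_map_map, h2, hLv]
      have hx' := abs_le.1 (abs_apply_zero_le_of_mem_hood hx)
      have hy' := abs_le.1 (abs_apply_zero_le_of_mem_hood hy)
      have := mul_le_mul_of_nonneg_left (show x 0 - y 0 ≤ 2 * rConst by linarith) hc.le
      linarith)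
  refine ⟨hpc, hq.trans ?_⟩
  field_simp

end MinkowskiGeom

theorem theorem1p5 :
    (∀ K : Set (EuclideanSpace ℝ (Fin 2)),
      MinkowskiGeom.IsPseudoComplete K MinkowskiGeom.unitDisk →
        MinkowskiGeom.diameter K MinkowskiGeom.unitDisk /
            MinkowskiGeom.width K MinkowskiGeom.unitDisk
          ≤ (1 / 2 : ℝ) * (1 + 1 / MinkowskiGeom.rConst)) ∧
    (∀ K : Set (EuclideanSpace ℝ (Fin 2)),
      MinkowskiGeom.IsHood K →
        MinkowskiGeom.IsPseudoComplete K MinkowskiGeom.unitDisk ∧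
        MinkowskiGeom.diameter K MinkowskiGeom.unitDisk /
            MinkowskiGeom.width K MinkowskiGeom.unitDisk
          = (1 / 2 : ℝ) * (1 + 1 / MinkowskiGeom.rConst)) ∧
    ((0.7935 : ℝ) < MinkowskiGeom.rConst ∧ MinkowskiGeom.rConst < 0.7936) ∧
    ((1.1300 : ℝ) < (1 / 2 : ℝ) * (1 + 1 / MinkowskiGeom.rConst) ∧
      (1 / 2 : ℝ) * (1 + 1 / MinkowskiGeom.rConst) < 1.1301) := by
  refine ⟨fun K hK => MinkowskiGeom.diameter_div_width_le hK,
    fun K hK => MinkowskiGeom.isPseudoComplete_of_isHood hK, ⟨?_, MinkowskiGeom.rConst_bounds.2⟩,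
    MinkowskiGeom.half_one_add_inv_rConst⟩
  linarith [MinkowskiGeom.rConst_bounds.1]
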